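/- Conventions. Let $\mathbb N=\{1,2,3,\dots\}$ and let $\mathcal O$ be the set of non-decreasing sequences $a:\mathbb N\to[0,\infty)$. Write $a\approx b$ if there are constants $c,C>0$ with $c\,a(n)\le b(n)\le C\,a(n)$ for all $n$; let $\mathbb O=\mathcal O/\!\approx$, and let $[a(n)]$ be the class of $a$. The set $\mathbb O$ is partially ordered by $[a(n)]\le[b(n)]$ iff there is $C>0$ with $a(n)\le C\,b(n)$ for all $n$. Let $\overline{\mathbb O}\supset\mathbb O$ be its Dedekind–MacNeille completion, in which all suprema below are taken. The class $[1]$ is called the constant order. For a continuous self-map $S$ of a compact metric space $(Y,d)$, put $d_n(x,y)=\max_{0\le i<n}d(S^ix,S^iy)$, and let $\mathrm{Sep}(S,n,\varepsilon)$ be the maximal cardinality of a set $A\subset Y$ with $d_n(x,y)\ge\varepsilon$ for all distinct $x,y\in A$. The generalized entropy of $S$ is $o(S)=\sup\{[\mathrm{Sep}(S,n,\varepsilon)]:\varepsilon>0\}\in\overline{\mathbb O}$. For a homeomorphism $T:S^1\to S^1$ of the circle, let $T_*\mu=\mu\circ T^{-1}$ be the induced map on the space $\mathcal M(S^1)$ of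 Borel probability measures with the weak-$*$ topology, metrized by any metric that induces this topology. **Corollary.** Let $T:S^1\to S^1$ be a homeomorphism of the circle. Then, for every metric on $\mathcal M(S^1)$ inducing the weak-$*$ topology, either $o(T_*)\ge\sup\{[n^t]:t\in(0,\infty)\}$ or $o(T_*)=[1]$. -/

import Mathlib

open MeasureTheory

noncomputable section

namespace GrowthOrder

/-! ### Orders of growth -/

/-- Non-decreasing sequences `a : {1, 2, 3, …} → [0, ∞)`. -/
structure GrowthSeq where
  toFun : ℕ+ → ℝ
  nonneg : ∀ n, 0 ≤ toFun n
  le_succ : ∀ n, toFun n ≤ toFun (n + 1)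

/-- `a ≈ b` if `c * a n ≤ b n ≤ C * a n` for all `n`, for some constants `c, C > 0`. -/
def GrowthSeq.Equivalent (a b : GrowthSeq) : Prop :=
  ∃ c : ℝ, 0 < c ∧ ∃ C : ℝ, 0 < C ∧ ∀ n, c * a.toFun n ≤ b.toFun n ∧ b.toFun n ≤ C * a.toFun n

/-- `a` is dominated by `b` if `a n ≤ C * b n` for all `n`, for some constant `C > 0`. -/
def GrowthSeq.Dominated (a b : GrowthSeq) : Prop :=
  ∃ C : ℝ, 0 < C ∧ ∀ n, a.toFun n ≤ C * b.toFun n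

theorem GrowthSeq.Dominated.refl (a : GrowthSeq) : a.Dominated a :=
  ⟨1, one_pos, fun n => by simp⟩

theorem GrowthSeq.Dominated.trans {a b c : GrowthSeq} (h₁ : a.Dominated b) (h₂ : b.Dominated c) :
    a.Dominated c := by
  obtain ⟨C, hC, h⟩ := h₁
  obtain ⟨D, hD, k⟩ := h₂
  refine ⟨C * D, mul_pos hC hD, fun n => (h n).trans ?_⟩
  rw [mul_assoc]
  exact mul_le_mul_of_nonneg_left (k n) hC.le

theorem GrowthSeq.equivalent_iff {a b : GrowthSeq} :
    a.Equivalent b ↔ a.Dominated b ∧ b.Dominated a := by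
  constructor
  · rintro ⟨c, hc, C, hC, h⟩
    exact ⟨⟨c⁻¹, inv_pos.2 hc, fun n => (le_inv_mul_iff₀ hc).2 (h n).1⟩,
      ⟨C, hC, fun n => (h n).2⟩⟩
  · rintro ⟨⟨c, hc, h⟩, ⟨C, hC, k⟩⟩
    exact ⟨c⁻¹, inv_pos.2 hc, C, hC, fun n => ⟨(inv_mul_le_iff₀ hc).2 (h n), k n⟩⟩

instance growthSetoid : Setoid GrowthSeq where
  r := GrowthSeq.Equivalent
  iseqv :=
    { refl := fun a => GrowthSeq.equivalent_iff.2 ⟨.refl a, .refl a⟩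
      symm := fun h => GrowthSeq.equivalent_iff.2 (GrowthSeq.equivalent_iff.1 h).symm
      trans := fun h k => GrowthSeq.equivalent_iff.2
        ⟨(GrowthSeq.equivalent_iff.1 h).1.trans (GrowthSeq.equivalent_iff.1 k).1,
          (GrowthSeq.equivalent_iff.1 k).2.trans (GrowthSeq.equivalent_iff.1 h).2⟩ }

/-- The space of orders of growth: growth sequences modulo equivalence. -/
def GrowthClass : Type := Quotient growthSetoid

/-- The class `[a(n)]` of a growth sequence. -/
def GrowthClass.mk (a : GrowthSeq) : GrowthClass := Quotient.mk growthSetoid a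

/-- `[a(n)] ≤ [b(n)]` iff `a n ≤ C * b n` for all `n`, for some constant `C > 0`. -/
instance : LE GrowthClass where
  le := Quotient.lift₂ GrowthSeq.Dominated fun _ _ _ _ h k =>
    propext
      ⟨fun d => ((GrowthSeq.equivalent_iff.1 h).2.trans d).trans (GrowthSeq.equivalent_iff.1 k).1,
        fun d => ((GrowthSeq.equivalent_iff.1 h).1.trans d).trans (GrowthSeq.equivalent_iff.1 k).2⟩

instance : PartialOrder GrowthClass where
  le_refl := fun x => Quotient.inductionOn x GrowthSeq.Dominated.refl
  le_trans := fun x y z => Quotient.inductionOn₃ x y z fun _ _ _ h k =>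
    GrowthSeq.Dominated.trans h k
  le_antisymm := fun x y => Quotient.inductionOn₂ x y fun _ _ h k =>
    Quotient.sound (GrowthSeq.equivalent_iff.2 ⟨h, k⟩)

/-- The Dedekind–MacNeille completion of the space of orders of growth (a complete lattice). -/
abbrev CompleteOrder : Type := DedekindCut GrowthClass

/-- The canonical embedding of the orders of growth in the completion. -/
def GrowthClass.toComplete (o : GrowthClass) : CompleteOrder := DedekindCut.principal o

/-- The supremum, in the completion, of a set of orders of growth. -/
def supOrders (S : Set GrowthClass) : CompleteOrder := sSup (GrowthClass.toComplete '' S)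

/-- The constant sequence `1`. -/
def oneSeq : GrowthSeq where
  toFun _ := 1
  nonneg _ := zero_le_one
  le_succ _ := le_rfl

/-- The constant order of growth `[1]`, as an element of the completion. -/
def constOrder : CompleteOrder := (GrowthClass.mk oneSeq).toComplete

/-- The sequence `n ^ t` (real exponent `t > 0`). -/
def powSeq (t : ℝ) (ht : 0 < t) : GrowthSeq where
  toFun n := (n : ℝ) ^ t
  nonneg n := Real.rpow_nonneg (Nat.cast_nonneg _) t
  le_succ n := Real.rpow_le_rpow (Nat.cast_nonneg _) (by push_cast; linarith) ht.le

/-- The family of polynomial orders of growth `{[n ^ t] : t > 0}`. -/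
def polynomialOrders : Set GrowthClass := {o | ∃ (t : ℝ) (ht : 0 < t), o = GrowthClass.mk (powSeq t ht)}

/-! ### Generalized topological entropy -/

/-- A metric on a topological space that induces its topology. -/
structure CompatibleMetric (Y : Type*) [t : TopologicalSpace Y] where
  toMetricSpace : MetricSpace Y
  topology_eq : toMetricSpace.toPseudoMetricSpace.toUniformSpace.toTopologicalSpace = t

/-- The distance function of a compatible metric. -/
def CompatibleMetric.d {Y : Type*} [TopologicalSpace Y] (ρ : CompatibleMetric Y) (x y : Y) : ℝ :=
  ρ.toMetricSpace.dist x y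

section Entropy

variable {Y : Type*} [TopologicalSpace Y]

/-- The dynamical distance `d_n(x, y) = max {d(Tⁱ x, Tⁱ y) : 0 ≤ i < n}`, for `n ≥ 1`. -/
def dynDist (ρ : CompatibleMetric Y) (T : C(Y, Y)) (n : ℕ+) (x y : Y) : ℝ :=
  (Finset.range n).sup' (Finset.nonempty_range_iff.2 n.ne_zero)
    fun i => ρ.d (T^[i] x) (T^[i] y)

/-- `A` is `(n, ε)`-separated: `d_n(x, y) ≥ ε` for distinct `x, y ∈ A`. -/
def IsSeparated (ρ : CompatibleMetric Y) (T : C(Y, Y)) (n : ℕ+) (ε : ℝ) (A : Finset Y) : Prop :=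
  ∀ x ∈ A, ∀ y ∈ A, x ≠ y → ε ≤ dynDist ρ T n x y

/-- `Sep(T, n, ε)`, the maximal cardinality of an `(n, ε)`-separated set. -/
def sep (ρ : CompatibleMetric Y) (T : C(Y, Y)) (n : ℕ+) (ε : ℝ) : ℕ :=
  sSup {k | ∃ A : Finset Y, IsSeparated ρ T n ε A ∧ A.card = k}

/-- On a compact space the cardinalities of `(n, ε)`-separated sets are bounded,
so that `sep` is a genuine maximum. -/
theorem bddAbove_card [CompactSpace Y] (ρ : CompatibleMetric Y) (T : C(Y, Y)) (n : ℕ+) {ε : ℝ}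
    (hε : 0 < ε) : BddAbove {k | ∃ A : Finset Y, IsSeparated ρ T n ε A ∧ A.card = k} := by
  classical
  obtain ⟨m, hm⟩ := ρ
  subst hm
  let U : Y → Set Y := fun x => {y | ∀ i ∈ Finset.range n, dist (T^[i] x) (T^[i] y) < ε / 2}
  have hU : ∀ x, U x ∈ nhds x := fun x => by
    refine (Filter.eventually_all_finset (Finset.range n)).2 fun i _ => ?_
    have hc : Continuous fun y => dist (T^[i] x) (T^[i] y) :=
      continuous_const.dist (T.continuous.iterate i)
    exact hc.continuousAt.eventually_lt continuousAt_const (by simpa using half_pos hε)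
  obtain ⟨s, -, hs⟩ := isCompact_univ.elim_nhds_subcover U fun x _ => hU x
  refine ⟨s.card, ?_⟩
  rintro _ ⟨A, hA, rfl⟩
  have hc : ∀ y, ∃ x ∈ s, y ∈ U x := fun y => by simpa using hs (Set.mem_univ y)
  choose f hfs hf using hc
  refine Finset.card_le_card_of_injOn f (fun y _ => hfs y) fun x hx y hy hxy => ?_
  by_contra hne
  have h := hA x hx y hy hne
  obtain ⟨i, hi, hle⟩ := (Finset.le_sup'_iff _).1 h
  have h₁ := hf x i hi
  have h₂ := hf y i hi
  rw [hxy] at h₁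
  have h₃ := dist_triangle_left (T^[i] x) (T^[i] y) (T^[i] (f y))
  have h₄ : ε ≤ dist (T^[i] x) (T^[i] y) := hle
  linarith

theorem sep_mono [CompactSpace Y] (ρ : CompatibleMetric Y) (T : C(Y, Y)) {ε : ℝ} (hε : 0 < ε)
    (n : ℕ+) : sep ρ T n ε ≤ sep ρ T (n + 1) ε := by
  refine csSup_le_csSup (bddAbove_card ρ T (n + 1) hε)
    ⟨0, ∅, by simp [IsSeparated], rfl⟩ ?_
  rintro _ ⟨A, hA, rfl⟩
  refine ⟨A, fun x hx y hy hxy => (hA x hx y hy hxy).trans ?_, rfl⟩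
  exact Finset.sup'_mono _ (Finset.range_mono (by simp)) _

/-- The growth sequence `n ↦ Sep(T, n, ε)`. -/
def sepSeq [CompactSpace Y] (ρ : CompatibleMetric Y) (T : C(Y, Y)) (ε : ℝ) (hε : 0 < ε) :
    GrowthSeq where
  toFun n := sep ρ T n ε
  nonneg _ := Nat.cast_nonneg _
  le_succ n := Nat.cast_le.2 (sep_mono ρ T hε n)

/-- The generalized entropy `o(T) = sup {[Sep(T, n, ε)] : ε > 0}` of a continuous self-map of a
compact metrizable space, computed with the metric `ρ`. -/
def genEntropy [CompactSpace Y] (ρ : CompatibleMetric Y) (T : C(Y, Y)) : CompleteOrder :=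
  supOrders {o | ∃ (ε : ℝ) (hε : 0 < ε), o = GrowthClass.mk (sepSeq ρ T ε hε)}

end Entropy

/-! ### The circle and the measure-induced map -/

/-- The Borel σ-algebra on the unit circle. -/
instance circleMeasurableSpace : MeasurableSpace Circle := borel Circle

instance circleBorelSpace : BorelSpace Circle := ⟨rfl⟩

/-- The push-forward map `T_* μ = μ ∘ T⁻¹` on the space of Borel probability measures, which carries
the weak-* topology. -/
def measureInduced {X : Type*} [TopologicalSpace X] [MeasurableSpace X] [BorelSpace X]
    (T : C(X, X)) : C(ProbabilityMeasure X, ProbabilityMeasure X) where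
  toFun μ := μ.map T.continuous.measurable.aemeasurable
  continuous_toFun := ProbabilityMeasure.continuous_map T.continuous

end GrowthOrder

end

open Filter Topology

namespace GrowthOrder

/-! ### Separated sets and bounds for the generalized entropy -/

section Entropy

variable {Y : Type*} [TopologicalSpace Y]

/-! The dichotomy comes from the dynamics of `T`: either its forward iterates are equicontinuous, or
some point `x` is isolated in its orbit under a power `T ^ q`.

In the first case the iterates lie in a compact set of maps. Since push-forward is jointly
continuous in map and measure, the iterates of `T_*` are equicontinuous too, and separated sets have
bounded size (`genEntropy_measureInduced_eq_constOrder`).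

In the second case, put mass `1/k` at each of `k` points chosen among `M` successive points of the
backward `T ^ q`-orbit of `x`. A bump function at `x` reads off the chosen times one by one, with
values `1/k` or `0`. The resulting `M.choose k` measures are separated at a scale depending on `k`
but not on `M`, and `M` is about `n / q`; this gives growth `n ^ k` for every `k`
(`supOrders_polynomialOrders_le_measureInduced`).

For the dichotomy (`uniformEquicontinuous_or_hasIsolatedOrbitPoint`), failure of equicontinuity
yields an open set `K` with arbitrarily small preimages, whose translates then cannot cover the
circle. A component of their union either never returns to itself, so that its points are isolated
in their orbits, or is preserved by a power of `T`, so that its finite frontier contains a periodic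
point. Cutting the circle at a periodic point reduces to increasing maps of the line, where every
moved point is isolated in its orbit. -/

theorem CompatibleMetric.continuous_d (ρ : CompatibleMetric Y) :
    Continuous fun z : Y × Y => ρ.d z.1 z.2 := by
  obtain ⟨m, hm⟩ := ρ
  subst hm
  exact continuous_dist

theorem CompatibleMetric.d_self (ρ : CompatibleMetric Y) (x : Y) : ρ.d x x = 0 :=
  ρ.toMetricSpace.dist_self x

theorem CompatibleMetric.d_comm (ρ : CompatibleMetric Y) (x y : Y) : ρ.d x y = ρ.d y x :=
  ρ.toMetricSpace.dist_comm x y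

theorem CompatibleMetric.d_triangle (ρ : CompatibleMetric Y) (x y z : Y) :
    ρ.d x z ≤ ρ.d x y + ρ.d y z :=
  ρ.toMetricSpace.dist_triangle x y z

theorem CompatibleMetric.exists_lt_of_d_lt [CompactSpace Y] (ρ : CompatibleMetric Y) {F : Y → ℝ}
    (hF : Continuous F) {η : ℝ} (hη : 0 < η) :
    ∃ ε > 0, ∀ x y, ρ.d x y < ε → |F x - F y| < η := by
  obtain ⟨m, hm⟩ := ρ
  subst hm
  exact Metric.uniformContinuous_iff.1 (CompactSpace.uniformContinuous_of_continuous hF) η hη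
    |>.imp fun ε h => ⟨h.1, fun x y hxy => h.2 hxy⟩

theorem card_le_sep [CompactSpace Y] (ρ : CompatibleMetric Y) (T : C(Y, Y)) (n : ℕ+) {ε : ℝ}
    (hε : 0 < ε) {A : Finset Y} (hA : IsSeparated ρ T n ε A) : A.card ≤ sep ρ T n ε :=
  le_csSup (bddAbove_card ρ T n hε) ⟨A, hA, rfl⟩

theorem one_le_sep [CompactSpace Y] [Nonempty Y] (ρ : CompatibleMetric Y) (T : C(Y, Y)) (n : ℕ+)
    {ε : ℝ} (hε : 0 < ε) : 1 ≤ sep ρ T n ε := by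
  obtain ⟨y⟩ := ‹Nonempty Y›
  refine card_le_sep ρ T n hε (A := {y}) fun x hx z hz hxz => ?_
  rw [Finset.mem_singleton] at hx hz
  exact absurd (hx.trans hz.symm) hxz

theorem le_dynDist (ρ : CompatibleMetric Y) (T : C(Y, Y)) {n : ℕ+} {i : ℕ} (hi : i < n) (x y : Y) :
    ρ.d (T^[i] x) (T^[i] y) ≤ dynDist ρ T n x y :=
  Finset.le_sup' (fun i => ρ.d (T^[i] x) (T^[i] y)) (Finset.mem_range.2 hi)

theorem toComplete_le_genEntropy [CompactSpace Y] (ρ : CompatibleMetric Y) (T : C(Y, Y))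
    {a : GrowthSeq} {ε : ℝ} (hε : 0 < ε) (h : a.Dominated (sepSeq ρ T ε hε)) :
    (GrowthClass.mk a).toComplete ≤ genEntropy ρ T :=
  (DedekindCut.principal_le_principal.2 (show GrowthClass.mk a ≤ GrowthClass.mk _ from h)).trans
    (le_sSup ⟨_, ⟨ε, hε, rfl⟩, rfl⟩)

/-- If the forward iterates of `T` are equicontinuous, the generalized entropy is constant. -/
theorem genEntropy_eq_constOrder [CompactSpace Y] [Nonempty Y] (ρ : CompatibleMetric Y)
    (T : C(Y, Y))
    (hT : ∀ y, ∀ ε > 0, ∀ᶠ z in 𝓝 y, ∀ n : ℕ, ρ.d (T^[n] y) (T^[n] z) < ε) :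
    genEntropy ρ T = constOrder := by
  apply le_antisymm
  · refine sSup_le ?_
    rintro _ ⟨_, ⟨ε, hε, rfl⟩, rfl⟩
    refine DedekindCut.principal_le_principal.2 ?_
    -- The covering sets control all times at once, so the size of the cover bounds `sep`
    -- independently of `n`.
    obtain ⟨s, -, hs⟩ := isCompact_univ.elim_nhds_subcover
      (fun y => {z | ∀ n : ℕ, ρ.d (T^[n] y) (T^[n] z) < ε / 2}) fun y _ => hT y _ (half_pos hε)
    have hc : ∀ y, ∃ x ∈ s, ∀ n : ℕ, ρ.d (T^[n] x) (T^[n] y) < ε / 2 := fun y => by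
      simpa using hs (Set.mem_univ y)
    choose f hfs hf using hc
    have hsep : ∀ n, sep ρ T n ε ≤ s.card := fun n => by
      refine csSup_le ⟨0, ∅, by simp [IsSeparated], rfl⟩ ?_
      rintro _ ⟨A, hA, rfl⟩
      refine Finset.card_le_card_of_injOn f (fun y _ => hfs y) fun x hx y hy hxy => ?_
      by_contra hne
      obtain ⟨i, -, hle⟩ := (Finset.le_sup'_iff _).1 (hA x hx y hy hne)
      have h₁ := hf x i
      have h₂ := hf y i
      rw [hxy, ρ.d_comm] at h₁
      have h₃ := ρ.d_triangle (T^[i] x) (T^[i] (f y)) (T^[i] y)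
      linarith
    refine ⟨s.card + 1, by positivity, fun n => ?_⟩
    have : (sep ρ T n ε : ℝ) ≤ s.card := Nat.cast_le.2 (hsep n)
    change (sep ρ T n ε : ℝ) ≤ (s.card + 1) * 1
    linarith
  · refine toComplete_le_genEntropy ρ T one_pos ⟨1, one_pos, fun n => ?_⟩
    rw [one_mul]
    exact Nat.one_le_cast.2 (one_le_sep ρ T n one_pos)

/-- If for each `k` the number of separated points is bounded below by `M.choose k`, where `M` grows
linearly, then the generalized entropy exceeds all polynomial orders. -/
theorem supOrders_polynomialOrders_le [CompactSpace Y] [Nonempty Y] (ρ : CompatibleMetric Y)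
    (T : C(Y, Y)) {q : ℕ}
    (h : ∀ k : ℕ, 0 < k → ∃ ε > 0, ∀ (n : ℕ+) (M : ℕ), q * M < n + q → M.choose k ≤ sep ρ T n ε)
    (hq : 0 < q) : supOrders polynomialOrders ≤ genEntropy ρ T := by
  refine sSup_le ?_
  rintro _ ⟨_, ⟨t, ht, rfl⟩, rfl⟩
  set k := ⌈t⌉₊ with hk
  have hk0 : 0 < k := Nat.ceil_pos.2 ht
  obtain ⟨ε, hε, hsep⟩ := h k hk0
  refine toComplete_le_genEntropy ρ T hε ⟨(q * k) ^ k * k.factorial, by positivity, fun n => ?_⟩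
  have hn : (1 : ℝ) ≤ n := Nat.one_le_cast.2 n.pos
  have h1 : ((n : ℕ) : ℝ) ^ t ≤ (n : ℝ) ^ k := by
    rw [← Real.rpow_natCast]
    exact Real.rpow_le_rpow_of_exponent_le hn (Nat.le_ceil t)
  refine h1.trans ?_
  change ((n : ℕ) : ℝ) ^ k ≤ (q * k) ^ k * k.factorial * (sep ρ T n ε : ℕ)
  norm_cast
  -- `M` is `n / q` rounded up, the largest value that the hypothesis `h` admits.
  obtain ⟨M, hM1, hM2⟩ : ∃ M, q * M < n + q ∧ (n : ℕ) ≤ q * M := by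
    refine ⟨(n + (q - 1)) / q, ?_, ?_⟩
    · have := Nat.mul_div_le (n + (q - 1)) q
      omega
    · have := Nat.lt_mul_div_succ (n + (q - 1)) hq
      rw [mul_add] at this
      omega
  -- For `M < k` the binomial coefficient vanishes, but then `n ≤ q * k` and the constant alone
  -- suffices.
  rcases lt_or_ge M k with hMk | hMk
  · calc (n : ℕ) ^ k ≤ (q * k) ^ k := Nat.pow_le_pow_left (hM2.trans (by gcongr)) k
      _ = (q * k) ^ k * 1 * 1 := by ring
      _ ≤ (q * k) ^ k * k.factorial * sep ρ T n ε := by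
        gcongr
        · exact Nat.one_le_iff_ne_zero.2 k.factorial_ne_zero
        · exact one_le_sep ρ T n hε
  · have h2 : M ≤ k * (M + 1 - k) := by
      obtain ⟨j, rfl⟩ := Nat.exists_eq_add_of_le hMk
      rw [show k + j + 1 - k = j + 1 by omega]
      nlinarith
    have h3 : (M + 1 - k) ^ k ≤ k.factorial * M.choose k := by
      have := Nat.pow_le_choose (α := ℝ) k M
      rw [div_le_iff₀ (by positivity)] at this
      rw [mul_comm]
      exact_mod_cast this
    calc (n : ℕ) ^ k ≤ (q * (k * (M + 1 - k))) ^ k :=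
          Nat.pow_le_pow_left (hM2.trans (by gcongr)) k
      _ = (q * k) ^ k * (M + 1 - k) ^ k := by rw [← mul_assoc, mul_pow]
      _ ≤ (q * k) ^ k * (k.factorial * M.choose k) := by gcongr
      _ ≤ (q * k) ^ k * (k.factorial * sep ρ T n ε) := by
        gcongr
        exact hsep n M hM1
      _ = _ := by ring

end Entropy

/-! ### Continuity of the push-forward and equicontinuity -/

section PushForward

variable {X : Type*} [TopologicalSpace X] [MeasurableSpace X] [BorelSpace X]

theorem iterate_measureInduced (T : C(X, X)) (n : ℕ) (μ : ProbabilityMeasure X) :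
    (measureInduced T)^[n] μ =
      μ.map (T.continuous.iterate n).measurable.aemeasurable := by
  induction n with
  | zero =>
    apply ProbabilityMeasure.toMeasure_injective
    simp
  | succ n ih =>
    rw [Function.iterate_succ_apply', ih]
    apply ProbabilityMeasure.toMeasure_injective
    have hn : Measurable (T^[n]) := (T.continuous.iterate n).measurable
    have h1 : Measurable T := T.continuous.measurable
    simp only [measureInduced, ContinuousMap.coe_mk, ProbabilityMeasure.toMeasure_map]
    rw [Measure.map_map h1 hn, Function.iterate_succ']

variable [CompactSpace X]

/-- Changing the integrand costs at most the sup norm of the change, uniformly over probability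
measures; changing the measure under a fixed integrand is weak-* continuity. -/
theorem continuous_integral_prod :
    Continuous fun z : C(X, ℝ) × ProbabilityMeasure X => ∫ x, z.1 x ∂(z.2 : Measure X) := by
  rw [continuous_iff_continuousAt]
  rintro ⟨h, ν⟩
  have hint : ∀ (g : C(X, ℝ)) (μ : ProbabilityMeasure X), Integrable g (μ : Measure X) :=
    fun g μ => g.continuous.integrable_of_hasCompactSupport (HasCompactSupport.of_compactSpace g)
  have h0 : Tendsto (fun z : C(X, ℝ) × ProbabilityMeasure X =>
      ‖z.1 - h‖ + |∫ x, h x ∂(z.2 : Measure X) - ∫ x, h x ∂(ν : Measure X)|) (𝓝 (h, ν)) (𝓝 0) := by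
    have : Continuous (fun z : C(X, ℝ) × ProbabilityMeasure X =>
      ‖z.1 - h‖ + |∫ x, h x ∂(z.2 : Measure X) - ∫ x, h x ∂(ν : Measure X)|) := by
      refine (continuous_fst.sub continuous_const).norm.add (Continuous.abs ?_)
      exact ((ProbabilityMeasure.continuous_integral_continuousMap h).comp continuous_snd).sub
        continuous_const
    simpa using this.tendsto (h, ν)
  refine tendsto_iff_dist_tendsto_zero.2 (squeeze_zero (fun _ => dist_nonneg) (fun z => ?_) h0)
  rw [Real.dist_eq]
  have h1 : |∫ x, z.1 x ∂(z.2 : Measure X) - ∫ x, h x ∂(z.2 : Measure X)| ≤ ‖z.1 - h‖ := by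
    rw [← integral_sub (hint _ _) (hint _ _), ← Real.norm_eq_abs]
    refine (norm_integral_le_of_norm_le_const (C := ‖z.1 - h‖) (Eventually.of_forall fun x => ?_)).trans
      (by simp)
    exact (z.1 - h).norm_coe_le_norm x
  exact (abs_sub_le _ (∫ x, h x ∂(z.2 : Measure X)) _).trans (add_le_add_left h1 _)

/-- The push-forward of measures is jointly continuous in the map and in the measure. -/
theorem continuous_measureInduced_prod :
    Continuous fun z : C(X, X) × ProbabilityMeasure X => measureInduced z.1 z.2 := by
  rw [ProbabilityMeasure.continuous_iff_forall_continuousMap_continuous_integral]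
  intro f
  have h : ∀ z : C(X, X) × ProbabilityMeasure X,
      ∫ x, f x ∂(measureInduced z.1 z.2 : Measure X) = ∫ x, (f.comp z.1) x ∂(z.2 : Measure X) :=
    fun z => integral_map z.1.continuous.measurable.aemeasurable
      f.continuous.measurable.aestronglyMeasurable
  simp_rw [h]
  exact continuous_integral_prod.comp
    (((ContinuousMap.continuous_postcomp f).comp continuous_fst).prodMk continuous_snd)

end PushForward

/-- A uniformly equicontinuous family of self-maps of a compact space is contained in a compact set
of continuous maps. -/
theorem exists_isCompact_of_uniformEquicontinuous {X ι : Type*} [MetricSpace X] [CompactSpace X]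
    {F : ι → C(X, X)} (hF : UniformEquicontinuous fun i => (F i : X → X)) :
    ∃ G : Set C(X, X), IsCompact G ∧ ∀ i, F i ∈ G := by
  rw [Metric.uniformEquicontinuous_iff] at hF
  choose! δ hδ hF using hF
  -- The non-strict inequality makes `P` closed, hence compact, for pointwise convergence;
  -- Arzelà–Ascoli transfers this to `C(X, X)`.
  let P : Set (X → X) := {g | ∀ ε > 0, ∀ x y, dist x y < δ ε → dist (g x) (g y) ≤ ε}
  have hP : ∀ g ∈ P, Continuous g := fun g hg => by
    refine UniformContinuous.continuous (Metric.uniformContinuous_iff.2 fun ε hε =>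
      ⟨δ (ε / 2), hδ _ (half_pos hε), fun x y hxy => ?_⟩)
    exact (hg _ (half_pos hε) _ _ hxy).trans_lt (half_lt_self hε)
  have hc : IsClosed P := by
    simp only [P, Set.ofPred_forall]
    refine isClosed_iInter fun ε => isClosed_iInter fun _ => isClosed_iInter fun x =>
      isClosed_iInter fun y => isClosed_iInter fun _ => ?_
    exact isClosed_le ((continuous_apply x).dist (continuous_apply y)) continuous_const
  refine ⟨{g | (g : X → X) ∈ P}, ArzelaAscoli.isCompact_of_equicontinuous _ ?_ ?_,
    fun i ε hε x y hxy => (hF ε hε x y hxy i).le⟩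
  · convert hc.isCompact
    ext g
    constructor
    · rintro ⟨g, hg, rfl⟩
      exact hg
    · exact fun hg => ⟨⟨g, hP g hg⟩, hg, rfl⟩
  · refine UniformEquicontinuous.equicontinuous (Metric.uniformEquicontinuous_iff.2 fun ε hε =>
      ⟨δ (ε / 2), hδ _ (half_pos hε), fun x y hxy i => ?_⟩)
    exact (i.2 _ (half_pos hε) _ _ hxy).trans_lt (half_lt_self hε)

/-- If the forward iterates of `T` are equicontinuous, so are those of the induced map. -/
theorem genEntropy_measureInduced_eq_constOrder {X : Type*} [MetricSpace X] [CompactSpace X]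
    [MeasurableSpace X] [BorelSpace X] [Nonempty X] (ρ : CompatibleMetric (ProbabilityMeasure X))
    (T : C(X, X)) (hT : UniformEquicontinuous fun n : ℕ => T^[n]) :
    genEntropy ρ (measureInduced T) = constOrder := by
  have : Nonempty (ProbabilityMeasure X) :=
    ‹Nonempty X›.map fun x => ⟨Measure.dirac x, inferInstance⟩
  let F : ℕ → C(X, X) := fun n => ⟨T^[n], T.continuous.iterate n⟩
  obtain ⟨G, hG, hFG⟩ := exists_isCompact_of_uniformEquicontinuous (F := F) hT
  refine genEntropy_eq_constOrder ρ _ fun μ ε hε => ?_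
  have hcont : Continuous fun z : C(X, X) × ProbabilityMeasure X =>
      ρ.d (measureInduced z.1 μ) (measureInduced z.1 z.2) :=
    ρ.continuous_d.comp ((continuous_measureInduced_prod.comp
      (continuous_fst.prodMk continuous_const)).prodMk continuous_measureInduced_prod)
  -- The distance vanishes on `G ×ˢ {μ}`, so compactness of `G` gives one neighbourhood of `μ` that
  -- serves every iterate.
  obtain ⟨U, V, -, hV, hGU, hμV, hUV⟩ := generalized_tube_lemma hG (isCompact_singleton (x := μ))
    (isOpen_Iio.preimage hcont) (n := _ ⁻¹' Set.Iio ε) (by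
      rintro ⟨g, ν⟩ ⟨-, rfl⟩
      simpa [ρ.d_self] using hε)
  filter_upwards [hV.mem_nhds (hμV rfl)] with ν hν n
  rw [iterate_measureInduced, iterate_measureInduced]
  exact hUV (Set.mk_mem_prod (hGU (hFG n)) hν)

/-! ### Atomic measures along an orbit and the polynomial lower bound -/

section Atoms

variable {X ι : Type*} [MeasurableSpace X]

/-- The uniform probability measure on the points `p i`, `i ∈ A`, counted with multiplicity. -/
noncomputable def uniformAtoms (p : ι → X) (A : Finset ι) (hA : A.Nonempty) : ProbabilityMeasure X :=
  ⟨(A.card : ENNReal)⁻¹ • ∑ i ∈ A, Measure.dirac (p i), ⟨by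
    simp only [Measure.smul_apply, Measure.finsetSum_apply, measure_univ, Finset.sum_const,
      nsmul_eq_mul, mul_one, smul_eq_mul]
    exact ENNReal.inv_mul_cancel (by simpa using hA.ne_empty) (by simp)⟩⟩

theorem integral_uniformAtoms [TopologicalSpace X] [CompactSpace X] [BorelSpace X]
    (p : ι → X) {A : Finset ι} (hA : A.Nonempty) (f : C(X, ℝ)) :
    ∫ x, f x ∂(uniformAtoms p A hA : Measure X) = (A.card : ℝ)⁻¹ * ∑ i ∈ A, f (p i) := by
  have hint : ∀ i ∈ A, Integrable f (Measure.dirac (p i)) := fun i _ =>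
    f.continuous.integrable_of_hasCompactSupport (HasCompactSupport.of_compactSpace f)
  simp only [uniformAtoms, ProbabilityMeasure.coe_mk]
  rw [integral_smul_measure, integral_finsetSum_measure hint]
  simp only [ENNReal.toReal_inv, ENNReal.toReal_natCast, smul_eq_mul]
  congr 1
  exact Finset.sum_congr rfl fun i _ => integral_dirac' _ _ f.continuous.stronglyMeasurable

end Atoms

theorem integral_iterate_measureInduced {X : Type*} [TopologicalSpace X] [CompactSpace X]
    [MeasurableSpace X] [BorelSpace X] (T : C(X, X)) (n : ℕ) (μ : ProbabilityMeasure X)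
    (f : C(X, ℝ)) :
    ∫ x, f x ∂((measureInduced T)^[n] μ : Measure X) =
      ∫ x, f.comp ⟨T^[n], T.continuous.iterate n⟩ x ∂(μ : Measure X) := by
  rw [iterate_measureInduced]
  exact integral_map (T.continuous.iterate n).measurable.aemeasurable
    f.continuous.measurable.aestronglyMeasurable

/-- If some point is isolated in its orbit under an iterate of `T`, then the generalized entropy of
the induced map is at least the supremum of the polynomial orders. -/
theorem supOrders_polynomialOrders_le_measureInduced {X : Type*} [MetricSpace X] [CompactSpace X]
    [MeasurableSpace X] [BorelSpace X] (ρ : CompatibleMetric (ProbabilityMeasure X)) (T : X ≃ₜ X)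
    {q : ℕ} (hq : 0 < q) {x : X} {U : Set X} (hU : IsOpen U) (hx : x ∈ U)
    (hxU : ∀ m : ℤ, m ≠ 0 → ((T ^ q) ^ m) x ∉ U) :
    supOrders polynomialOrders ≤ genEntropy ρ (measureInduced (T : C(X, X))) := by
  classical
  have : Nonempty (ProbabilityMeasure X) := ⟨Measure.dirac x, inferInstance⟩
  refine supOrders_polynomialOrders_le ρ _ (q := q) (fun k hk => ?_) hq
  obtain ⟨f, hf0, hf1, -⟩ := exists_continuous_zero_one_of_isClosed hU.isClosed_compl
    (isClosed_singleton (x := x)) (Set.disjoint_singleton_right.2 fun h => h hx)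
  replace hf1 : f x = 1 := hf1 rfl
  have hk' : (0 : ℝ) < (k : ℝ)⁻¹ := by positivity
  obtain ⟨ε, hε, hεf⟩ := ρ.exists_lt_of_d_lt
    (ProbabilityMeasure.continuous_integral_continuousMap f) hk'
  refine ⟨ε, hε, fun n M hM => ?_⟩
  -- The point `p i` reaches `x` at time `q * i`; at every other multiple of `q` it is outside `U`,
  -- where `f` vanishes.
  let p : ℕ → X := fun i => ((T ^ q) ^ (-(i : ℤ))) x
  have hp : ∀ i j : ℕ, f (T^[q * j] (p i)) = if i = j then 1 else 0 := fun i j => by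
    have h : T^[q * j] (p i) = ((T ^ q) ^ ((j : ℤ) - i)) x := by
      have h1 : ∀ (n : ℕ) (y : X), T^[n] y = (T ^ n) y := fun n y => by
        induction n with
        | zero => rfl
        | succ n ih => rw [Function.iterate_succ_apply', ih, pow_succ']; rfl
      rw [h1, sub_eq_add_neg, zpow_add, zpow_natCast, pow_mul]
      rfl
    rw [h]
    split_ifs with hij
    · rw [hij, sub_self, zpow_zero]
      exact hf1
    · exact hf0 (hxU _ (by omega))
  let μ : Finset ℕ → ProbabilityMeasure X := fun A =>
    if hA : A.Nonempty then uniformAtoms p A hA else Classical.arbitrary _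
  have hμ : ∀ A : Finset ℕ, A.card = k → ∀ j,
      ∫ y, f y ∂((measureInduced (T : C(X, X)))^[q * j] (μ A) : Measure X) =
        if j ∈ A then (k : ℝ)⁻¹ else 0 := fun A hA j => by
    have hne : A.Nonempty := Finset.card_pos.1 (hA ▸ hk)
    rw [integral_iterate_measureInduced]
    simp only [μ, dif_pos hne]
    rw [integral_uniformAtoms]
    have : ∀ i ∈ A, (f.comp ⟨T^[q * j], (T : C(X, X)).continuous.iterate (q * j)⟩) (p i) =
      if i = j then 1 else 0 := fun i _ => hp i j
    refine (congrArg _ (Finset.sum_congr rfl this)).trans ?_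
    rw [Finset.sum_ite_eq', hA]
    split_ifs <;> simp
  have hsep : ∀ A ∈ (Finset.range M).powersetCard k, ∀ B ∈ (Finset.range M).powersetCard k,
      A ≠ B → ε ≤ dynDist ρ (measureInduced (T : C(X, X))) n (μ A) (μ B) := fun A hA B hB hAB => by
    rw [Finset.mem_powersetCard] at hA hB
    obtain ⟨j, hj⟩ : ∃ j, ¬(j ∈ A ↔ j ∈ B) := by
      by_contra! h
      exact hAB (Finset.ext h)
    have hjM : j < M := by
      by_cases hjA : j ∈ A
      · exact Finset.mem_range.1 (hA.1 hjA)
      · exact Finset.mem_range.1 (hB.1 (by tauto))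
    -- Only times up to `q * (M - 1)` are needed, whence the bound `q * M < n + q`.
    have hjn : q * j < n := by nlinarith
    refine le_trans (not_lt.1 fun hlt => ?_) (le_dynDist ρ _ hjn (μ A) (μ B))
    have h := hεf _ _ hlt
    rw [hμ A hA.2, hμ B hB.2] at h
    by_cases hjA : j ∈ A <;> by_cases hjB : j ∈ B <;>
      simp [hjA, hjB] at h hj
  have hinj : Set.InjOn μ ((Finset.range M).powersetCard k) := fun A hA B hB hAB => by
    by_contra hne
    have h := hsep A hA B hB hne
    rw [hAB] at h
    have h0 : dynDist ρ (measureInduced (T : C(X, X))) n (μ B) (μ B) ≤ 0 :=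
      Finset.sup'_le _ _ fun i _ => (ρ.d_self _).le
    linarith
  have hcard := card_le_sep ρ (measureInduced (T : C(X, X))) n hε
    (A := ((Finset.range M).powersetCard k).image μ) (by
      intro a ha b hb hab
      obtain ⟨A, hA, rfl⟩ := Finset.mem_image.1 ha
      obtain ⟨B, hB, rfl⟩ := Finset.mem_image.1 hb
      exact hsep A hA B hB fun h => hab (h ▸ rfl))
  rwa [Finset.card_image_of_injOn hinj, Finset.card_powersetCard, Finset.card_range] at hcard

/-! ### Orbits on the line and circle homeomorphisms with a periodic point -/

theorem iterate_eq_pow {X : Type*} [TopologicalSpace X] (T : X ≃ₜ X) (n : ℕ) :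
    (T : X → X)^[n] = (T ^ n : X ≃ₜ X) := by
  induction n with
  | zero => rfl
  | succ n ih => rw [Function.iterate_succ', ih, pow_succ']; rfl

/-- Some point is isolated in its orbit under a positive iterate of `T`, which does not fix it. -/
def HasIsolatedOrbitPoint {X : Type*} [TopologicalSpace X] (T : X ≃ₜ X) : Prop :=
  ∃ q : ℕ, 0 < q ∧ ∃ x, ∃ U : Set X, IsOpen U ∧ x ∈ U ∧ ∀ m : ℤ, m ≠ 0 → ((T ^ q) ^ m) x ∉ U

theorem semiconj_zpow {X Y : Type*} [TopologicalSpace X] [TopologicalSpace Y] {h : X ≃ₜ X}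
    {S : Y ≃ₜ Y} {ψ : X → Y} (hψ : ∀ x, ψ (h x) = S (ψ x)) (m : ℤ) (x : X) :
    ψ ((h ^ m) x) = (S ^ m) (ψ x) := by
  have hinv : ∀ x, ψ (h⁻¹ x) = S⁻¹ (ψ x) := fun x => by
    rw [← S.injective.eq_iff, ← hψ]
    exact (congrArg ψ (h.apply_symm_apply x)).trans (S.apply_symm_apply _).symm
  induction m generalizing x with
  | zero => rfl
  | succ n ih =>
    rw [zpow_add_one, zpow_add_one]
    exact (ih (h x)).trans (congrArg _ (hψ x))
  | pred n ih =>
    rw [zpow_sub_one, zpow_sub_one]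
    exact (ih (h⁻¹ x)).trans (congrArg _ (hinv x))

/-- The orbit is increasing, so `y` is its only point strictly between `h⁻¹ y` and `h y`. -/
theorem exists_isOpen_zpow_notMem_of_lt {h : ℝ ≃ₜ ℝ} (hm : StrictMono h) {y : ℝ} (hy : y < h y) :
    ∃ V : Set ℝ, IsOpen V ∧ y ∈ V ∧ ∀ m : ℤ, m ≠ 0 → (h ^ m) y ∉ V := by
  have hs : Monotone (h⁻¹ : ℝ ≃ₜ ℝ) := fun a b hab => by
    refine hm.le_iff_le.1 ?_
    rwa [show h (h⁻¹ a) = a from h.apply_symm_apply a, show h (h⁻¹ b) = b from h.apply_symm_apply b]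
  have hy' : h⁻¹ y < y := by
    refine hm.lt_iff_lt.1 ?_
    rwa [show h (h⁻¹ y) = y from h.apply_symm_apply y]
  refine ⟨Set.Ioo (h⁻¹ y) (h y), isOpen_Ioo, ⟨hy', hy⟩, fun m hm0 hmem => ?_⟩
  rcases lt_or_gt_of_ne hm0 with hneg | hpos
  · obtain ⟨n, rfl⟩ : ∃ n : ℕ, m = -((n + 1 : ℕ) : ℤ) := ⟨(-m - 1).toNat, by omega⟩
    have h1 := hs.antitone_iterate_of_map_le hy'.le (show 1 ≤ n + 1 by omega)
    rw [zpow_neg, zpow_natCast, ← inv_pow, ← iterate_eq_pow] at hmem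
    exact absurd hmem.1 (not_lt.2 h1)
  · obtain ⟨n, rfl⟩ : ∃ n : ℕ, m = ((n + 1 : ℕ) : ℤ) := ⟨(m - 1).toNat, by omega⟩
    have h1 := hm.monotone.monotone_iterate_of_le_map hy.le (show 1 ≤ n + 1 by omega)
    rw [zpow_natCast, ← iterate_eq_pow] at hmem
    exact absurd hmem.2 (not_lt.2 h1)

/-- A point moved by an increasing homeomorphism of the line is isolated in its orbit. -/
theorem exists_isOpen_zpow_notMem {h : ℝ ≃ₜ ℝ} (hm : StrictMono h) {y : ℝ} (hy : h y ≠ y) :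
    ∃ V : Set ℝ, IsOpen V ∧ y ∈ V ∧ ∀ m : ℤ, m ≠ 0 → (h ^ m) y ∉ V := by
  rcases lt_or_gt_of_ne hy with hlt | hgt
  · have hs : StrictMono (h⁻¹ : ℝ ≃ₜ ℝ) := fun a b hab => by
      refine hm.lt_iff_lt.1 ?_
      rwa [show h (h⁻¹ a) = a from h.apply_symm_apply a,
        show h (h⁻¹ b) = b from h.apply_symm_apply b]
    obtain ⟨V, hV, hyV, hVm⟩ := exists_isOpen_zpow_notMem_of_lt hs (y := y) (by
      refine hm.lt_iff_lt.1 ?_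
      rwa [show h (h⁻¹ y) = y from h.apply_symm_apply y])
    refine ⟨V, hV, hyV, fun m hm0 => ?_⟩
    have := hVm (-m) (by omega)
    rwa [inv_zpow', neg_neg] at this
  · exact exists_isOpen_zpow_notMem_of_lt hm hgt

/-- The angle from the antipode of `p` runs over `(-π, π)`, which `2 * arctan` parametrizes by the
line. -/
theorem exists_isOpenEmbedding_range_eq_compl (p : Circle) :
    ∃ ψ : ℝ → Circle, IsOpenEmbedding ψ ∧ Set.range ψ = {p}ᶜ := by
  have hlt : ∀ t, -Real.pi < 2 * Real.arctan t := fun t => by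
    linarith [Real.neg_pi_div_two_lt_arctan t]
  have hgt : ∀ t, 2 * Real.arctan t < Real.pi := fun t => by
    linarith [Real.arctan_lt_pi_div_two t]
  have harctan : IsOpenMap Real.arctan :=
    (isOpen_Ioo.isOpenMap_subtype_val).comp
      Real.tanOrderIso.symm.toHomeomorph.isOpenMap
  refine ⟨fun t => p * Circle.exp Real.pi * Circle.exp (2 * Real.arctan t),
    IsOpenEmbedding.of_continuous_injective_isOpenMap ?_ ?_ ?_, ?_⟩
  · have := Real.continuous_arctan
    fun_prop
  · intro s t hst
    have h1 := mul_left_cancel hst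
    have h2 := Circle.exp_injOn_Ioc (a := -Real.pi) (b := Real.pi) (by linarith)
      ⟨hlt s, (hgt s).le⟩ ⟨hlt t, (hgt t).le⟩ h1
    exact Real.arctan_injective (by linarith)
  · exact (isOpenMap_mul_left _).comp (isLocalHomeomorph_circleExp.isOpenMap.comp
      ((Homeomorph.mulLeft₀ (2 : ℝ) two_ne_zero).isOpenMap.comp harctan))
  · ext z
    constructor
    · rintro ⟨t, rfl⟩ h
      simp only [Set.mem_singleton_iff] at h
      rw [mul_assoc, mul_eq_left, ← Circle.exp_add, Circle.exp_eq_one] at h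
      obtain ⟨n, hn⟩ := h
      have hpi := Real.pi_pos
      have h1 : (0 : ℝ) < n := by
        by_contra! h0
        nlinarith [hlt t]
      have h2 : (n : ℝ) < 1 := by
        by_contra! h0
        nlinarith [hgt t]
      have h3 : 0 < n := by exact_mod_cast h1
      have h4 : n < 1 := by exact_mod_cast h2
      omega
    · intro hz
      set w := (p * Circle.exp Real.pi)⁻¹ * z with hw
      have hw' : p * Circle.exp Real.pi * w = z := by rw [hw, mul_inv_cancel_left]
      set θ := Complex.arg (w : ℂ) with hθ
      have hθw : Circle.exp θ = w := Circle.exp_arg w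
      have hθ2 : θ < Real.pi := by
        refine lt_of_le_of_ne (Complex.arg_le_pi _) fun h => hz ?_
        rw [h] at hθw
        rw [Set.mem_singleton_iff, ← hw', ← hθw, mul_assoc, ← Circle.exp_add, ← two_mul,
          Circle.exp_two_pi, mul_one]
      have hθ1 : -Real.pi < θ := Complex.neg_pi_lt_arg _
      refine ⟨Real.tan (θ / 2), ?_⟩
      rw [← hw', ← hθw]
      simp only
      rw [Real.arctan_tan (by linarith) (by linarith), mul_div_cancel₀ _ two_ne_zero]

instance : Infinite Circle :=
  have ⟨_, hψ, _⟩ := exists_isOpenEmbedding_range_eq_compl 1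
  Infinite.of_injective _ hψ.injective

instance : LocallyConnectedSpace Circle :=
  ChartedSpace.locallyConnectedSpace (EuclideanSpace ℝ (Fin 1)) Circle

/-- A circle homeomorphism with a periodic point is of finite order, or it moves a point which is
isolated in its orbit under an iterate. -/
theorem pow_eq_one_or_hasIsolatedOrbitPoint {T : Circle ≃ₜ Circle} {q : ℕ} (hq : 0 < q)
    {p : Circle} (hp : (T ^ q) p = p) : T ^ (q * 2) = 1 ∨ HasIsolatedOrbitPoint T := by
  obtain ⟨ψ, hψ, hrange⟩ := exists_isOpenEmbedding_range_eq_compl p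
  set S := T ^ q with hS
  have hmem : ∀ z, z ∈ Set.range ψ ↔ S z ∈ Set.range ψ := fun z => by
    rw [hrange, Set.mem_compl_singleton_iff, Set.mem_compl_singleton_iff, not_iff_not]
    nth_rewrite 2 [← hp]
    exact S.injective.eq_iff.symm
  let e : ℝ ≃ₜ Set.range ψ := hψ.isEmbedding.toHomeomorph
  let g : ℝ ≃ₜ ℝ := (e.trans (S.subtype hmem)).trans e.symm
  have hg : ∀ t, ψ (g t) = S (ψ t) := fun t =>
    congrArg Subtype.val (e.apply_symm_apply (S.subtype hmem (e t)))
  -- `g` may reverse orientation, but its square never does; hence the exponent `q * 2`.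
  have hmono : StrictMono (g ^ 2 : ℝ ≃ₜ ℝ) := by
    rcases g.continuous.strictMono_of_inj g.injective with h | h
    · exact h.comp h
    · exact h.comp h
  have hg2 : ∀ t, ψ ((g ^ 2) t) = (S ^ 2) (ψ t) := fun t => by
    exact_mod_cast semiconj_zpow hg 2 t
  have hT2 : S ^ 2 = T ^ (q * 2) := by rw [hS, pow_mul]
  by_cases hid : ∀ t, (g ^ 2) t = t
  · left
    rw [← hT2]
    ext1 z
    by_cases hz : z = p
    · rw [hz, pow_two]
      exact (congrArg S hp).trans hp
    · obtain ⟨t, rfl⟩ : z ∈ Set.range ψ := by rwa [hrange]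
      rw [← hg2, hid]
      rfl
  · right
    push Not at hid
    obtain ⟨t, ht⟩ := hid
    obtain ⟨V, hV, htV, hVm⟩ := exists_isOpen_zpow_notMem hmono ht
    refine ⟨q * 2, by omega, ψ t, ψ '' V, hψ.isOpenMap V hV, Set.mem_image_of_mem ψ htV,
      fun m hm0 => ?_⟩
    rw [← hT2, ← semiconj_zpow hg2]
    exact fun h => hVm m hm0 ((hψ.injective.mem_set_image).1 h)

/-- Only finitely many distinct maps occur among the iterates. -/
theorem uniformEquicontinuous_iterate_of_pow_eq_one {X : Type*} [UniformSpace X] [CompactSpace X]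
    {T : X ≃ₜ X} {N : ℕ} (hN : 0 < N) (hT : T ^ N = 1) :
    UniformEquicontinuous fun n : ℕ => (T : X → X)^[n] := by
  have h : UniformEquicontinuous fun i : Fin N => (T : X → X)^[i] :=
    uniformEquicontinuous_finite.2 fun i =>
      CompactSpace.uniformContinuous_of_continuous (T.continuous.iterate i)
  convert h.comp fun n : ℕ => ⟨n % N, Nat.mod_lt n hN⟩ using 1
  ext n x
  simp only [Function.comp, iterate_eq_pow]
  rw [pow_eq_pow_mod n hT]

/-! ### Connected subsets of the circle -/

/-- Connected subsets of the circle have finite frontier. -/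
theorem finite_frontier_of_isPreconnected {C : Set Circle} (hC : IsPreconnected C) :
    (frontier C).Finite := by
  by_cases hu : C = Set.univ
  · simp [hu]
  -- Seen from a missed point `p`, the set is an interval of the line; passing back to the circle
  -- adds at most `p` to the frontier.
  obtain ⟨p, hp⟩ := (Set.ne_univ_iff_exists_notMem C).1 hu
  obtain ⟨ψ, hψ, hrange⟩ := exists_isOpenEmbedding_range_eq_compl p
  have hCr : C ⊆ Set.range ψ := by
    rw [hrange]
    exact fun z hz h => hp (h ▸ hz)
  have hfin : (frontier (ψ ⁻¹' C)).Finite := by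
    have h := (hC.preimage_of_isOpenMap hψ.injective hψ.isOpenMap hCr).mem_intervals
    have h1 : ∀ {s : Set ℝ} {a b : ℝ}, Set.Ioo a b ⊆ s → s ⊆ Set.Icc a b →
        (frontier s).Finite := fun {s a b} hs hs' => by
      refine (Set.toFinite {a, b}).subset fun x hx => ?_
      have hx1 : x ∈ Set.Icc a b := isClosed_Icc.closure_subset_iff.2 hs' hx.1
      have hx2 : x ∉ Set.Ioo a b := fun h => hx.2 (interior_maximal hs isOpen_Ioo h)
      by_contra hne
      simp only [Set.mem_insert_iff, Set.mem_singleton_iff, not_or] at hne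
      exact hx2 ⟨lt_of_le_of_ne hx1.1 (Ne.symm hne.1), lt_of_le_of_ne hx1.2 hne.2⟩
    rcases h with h | h | h | h | h | h | h | h | h | h <;> rw [h]
    · exact h1 Set.Ioo_subset_Icc_self subset_rfl
    · exact h1 Set.Ioo_subset_Ico_self Set.Ico_subset_Icc_self
    · exact h1 Set.Ioo_subset_Ioc_self Set.Ioc_subset_Icc_self
    · exact h1 subset_rfl Set.Ioo_subset_Icc_self
    all_goals simp
  refine ((hfin.image ψ).insert p).subset fun z hz => ?_
  by_cases hzp : z = p
  · exact Or.inl hzp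
  · obtain ⟨t, rfl⟩ : z ∈ Set.range ψ := by rwa [hrange]
    right
    refine ⟨t, ?_, rfl⟩
    rw [← hψ.isOpenMap.preimage_frontier_eq_frontier_preimage hψ.continuous]
    exact hz

theorem exists_pos_forall_le {ι : Type*} [Finite ι] {f : ι → ℝ} (hf : ∀ i, 0 < f i) :
    ∃ d > 0, ∀ i, d ≤ f i := by
  have h : ∀ᶠ d in 𝓝[>] (0 : ℝ), ∀ i, d ≤ f i :=
    eventually_all.2 fun i => nhdsWithin_le_nhds (Iic_mem_nhds (hf i))
  obtain ⟨d, hd, hd0⟩ := (h.and self_mem_nhdsWithin).exists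
  exact ⟨d, hd0, hd⟩

theorem exists_exp_eq_mem_Ioc (a : ℝ) (z : Circle) :
    ∃ θ ∈ Set.Ioc a (a + 2 * Real.pi), Circle.exp θ = z := by
  obtain ⟨θ, rfl⟩ := Circle.exp_surjective z
  have h : Circle.exp θ ∈ Circle.exp '' Set.Ioc a (a + 2 * Real.pi) := by
    rw [Circle.periodic_exp.image_Ioc Real.two_pi_pos]
    exact ⟨θ, rfl⟩
  exact h

/-- A connected subset of the circle joining neighbourhoods of two distinct points contains one of
two open arcs. -/
theorem exists_isOpen_subset_of_isPreconnected {u v : Circle} (huv : u ≠ v) :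
    ∃ U V K₁ K₂ : Set Circle, IsOpen U ∧ IsOpen V ∧ IsOpen K₁ ∧ IsOpen K₂ ∧ u ∈ U ∧ v ∈ V ∧
      K₁.Nonempty ∧ K₂.Nonempty ∧ ∀ C : Set Circle, IsPreconnected C → (C ∩ U).Nonempty →
        (C ∩ V).Nonempty → K₁ ⊆ C ∨ K₂ ⊆ C := by
  obtain ⟨s, rfl⟩ := Circle.exp_surjective u
  obtain ⟨t, ⟨hst, hts⟩, rfl⟩ := exists_exp_eq_mem_Ioc s v
  replace hts : t < s + 2 * Real.pi := lt_of_le_of_ne hts fun h => huv (by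
    rw [h, Circle.exp_add_two_pi])
  have hopen : ∀ a b : ℝ, IsOpen (Circle.exp '' Set.Ioo a b) := fun a b =>
    isLocalHomeomorph_circleExp.isOpenMap _ isOpen_Ioo
  -- `U` and `V` are the arcs of radius `r` about the two points, `K₁` and `K₂` the gaps between
  -- them.
  obtain ⟨r, hr, hr1, hr2⟩ : ∃ r > 0, s + 2 * r < t - r ∧ t + 2 * r < s + 2 * Real.pi - r := by
    refine ⟨min (t - s) (s + 2 * Real.pi - t) / 4, ?_, ?_, ?_⟩
    · have := lt_min (sub_pos.2 hst) (sub_pos.2 hts)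
      positivity
    · have := min_le_left (t - s) (s + 2 * Real.pi - t)
      linarith
    · have := min_le_right (t - s) (s + 2 * Real.pi - t)
      linarith
  refine ⟨_, _, _, _, hopen (s - r) (s + r), hopen (t - r) (t + r), hopen (s + r) (t - r),
    hopen (t + r) (s + 2 * Real.pi - r), ⟨s, ⟨by linarith, by linarith⟩, rfl⟩,
    ⟨t, ⟨by linarith, by linarith⟩, rfl⟩, (Set.nonempty_Ioo.2 (by linarith)).image _,
    (Set.nonempty_Ioo.2 (by linarith)).image _, fun C hC hCU hCV => ?_⟩
  by_contra! h
  obtain ⟨⟨_, ⟨α, hα, rfl⟩, hαC⟩, ⟨_, ⟨β, hβ, rfl⟩, hβC⟩⟩ :=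
    And.intro (Set.not_subset.1 h.1) (Set.not_subset.1 h.2)
  -- Missing a point in each gap, `C` would be split by the two complementary open arcs, one
  -- containing `U` and the other `V`.
  obtain ⟨_, -, ⟨x, hx, rfl⟩, ⟨y, hy, hxy⟩⟩ := hC (Circle.exp '' Set.Ioo (β - 2 * Real.pi) α)
    (Circle.exp '' Set.Ioo α β) (hopen _ _) (hopen _ _) (fun z hz => by
      obtain ⟨θ, ⟨h1, h2⟩, rfl⟩ := exists_exp_eq_mem_Ioc (β - 2 * Real.pi) z
      rw [sub_add_cancel] at h2
      replace h2 : θ < β := lt_of_le_of_ne h2 fun h => hβC (h ▸ hz)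
      rcases lt_trichotomy θ α with h3 | rfl | h3
      · exact Or.inl ⟨θ, ⟨h1, h3⟩, rfl⟩
      · exact absurd hz hαC
      · exact Or.inr ⟨θ, ⟨h3, h2⟩, rfl⟩)
    (hCU.mono (Set.inter_subset_inter_right _ (Set.image_mono
      (Set.Ioo_subset_Ioo (by linarith [hβ.2]) hα.1.le))))
    (hCV.mono (Set.inter_subset_inter_right _ (Set.image_mono
      (Set.Ioo_subset_Ioo hα.2.le hβ.1.le))))
  have := Circle.exp_injOn_Ioc (a := β - 2 * Real.pi) (b := β) (by linarith)
    ⟨by linarith [hα.1, hβ.2, hy.1], hy.2.le⟩ ⟨hx.1, by linarith [hx.2, hα.2, hβ.1]⟩ hxy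
  linarith [hx.2, hy.1]

/-- Connected subsets of the circle of diameter at least `ε` contain one of finitely many open
sets. -/
theorem exists_finite_isOpen_subset_of_isPreconnected {ε : ℝ} (hε : 0 < ε) :
    ∃ 𝒦 : Set (Set Circle), 𝒦.Finite ∧ (∀ K ∈ 𝒦, IsOpen K ∧ K.Nonempty) ∧
      ∀ C : Set Circle, IsPreconnected C → ∀ u ∈ C, ∀ v ∈ C, ε ≤ dist u v → ∃ K ∈ 𝒦, K ⊆ C := by
  have h : ∀ z : Circle × Circle, ε ≤ dist z.1 z.2 → _ := fun z hz =>
    exists_isOpen_subset_of_isPreconnected (dist_pos.1 (hε.trans_le hz))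
  choose! U V K₁ K₂ hU hV hK₁ hK₂ hzU hzV hK₁n hK₂n hC using h
  have hcpt : IsCompact {z : Circle × Circle | ε ≤ dist z.1 z.2} :=
    (isClosed_le continuous_const continuous_dist).isCompact
  obtain ⟨t, ht, hcov⟩ := hcpt.elim_nhds_subcover (fun z => U z ×ˢ V z) fun z hz =>
    ((hU z hz).prod (hV z hz)).mem_nhds ⟨hzU z hz, hzV z hz⟩
  refine ⟨K₁ '' t ∪ K₂ '' t, (t.finite_toSet.image _).union (t.finite_toSet.image _), ?_, ?_⟩
  · rintro _ (⟨z, hz, rfl⟩ | ⟨z, hz, rfl⟩)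
    · exact ⟨hK₁ z (ht z hz), hK₁n z (ht z hz)⟩
    · exact ⟨hK₂ z (ht z hz), hK₂n z (ht z hz)⟩
  · intro C hCc u hu v hv huv
    obtain ⟨z, hz, huz, hvz⟩ : ∃ z ∈ t, u ∈ U z ∧ v ∈ V z := by
      have h := hcov (show (u, v) ∈ {z : Circle × Circle | ε ≤ dist z.1 z.2} from huv)
      simpa only [Set.mem_iUnion, exists_prop, Set.mem_prod] using h
    rcases hC z (ht z hz) C hCc ⟨u, hu, huz⟩ ⟨v, hv, hvz⟩ with h | h
    · exact ⟨_, Or.inl ⟨z, hz, rfl⟩, h⟩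
    · exact ⟨_, Or.inr ⟨z, hz, rfl⟩, h⟩

/-- In a compact locally connected space nearby points lie in small connected sets. -/
theorem exists_isPreconnected_of_dist_lt (X : Type*) [MetricSpace X] [CompactSpace X]
    [LocallyConnectedSpace X] {δ : ℝ} (hδ : 0 < δ) :
    ∃ η > 0, ∀ x y : X, dist x y < η → ∃ C : Set X, IsPreconnected C ∧ x ∈ C ∧ y ∈ C ∧
      ∀ a ∈ C, ∀ b ∈ C, dist a b < δ := by
  have h : ∀ x : X, ∃ V ⊆ Metric.ball x (δ / 2), IsOpen V ∧ x ∈ V ∧ IsConnected V := fun x =>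
    locallyConnectedSpace_iff_subsets_isOpen_isConnected.1 ‹_› x _
      (Metric.ball_mem_nhds x (half_pos hδ))
  choose V hVb hVo hxV hVc using h
  obtain ⟨η, hη, hV⟩ := lebesgue_number_lemma_of_metric isCompact_univ hVo
    fun x _ => Set.mem_iUnion.2 ⟨x, hxV x⟩
  refine ⟨η, hη, fun x y hxy => ?_⟩
  obtain ⟨i, hi⟩ := hV x trivial
  refine ⟨V i, (hVc i).isPreconnected, hi (Metric.mem_ball_self hη),
    hi (Metric.mem_ball'.2 hxy), fun a ha b hb => ?_⟩
  have h1 := Metric.mem_ball.1 (hVb i ha)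
  have h2 := Metric.mem_ball'.1 (hVb i hb)
  linarith [dist_triangle a i b]

/-! ### The dichotomy for circle homeomorphisms -/

/-- If the forward iterates of a circle homeomorphism are not equicontinuous, then some open set
has arbitrarily small preimages. -/
theorem exists_isOpen_small_preimages {T : Circle ≃ₜ Circle}
    (hT : ¬UniformEquicontinuous fun n : ℕ => (T : Circle → Circle)^[n]) :
    ∃ K : Set Circle, IsOpen K ∧ K.Nonempty ∧
      ∀ δ > 0, ∃ S : Circle ≃ₜ Circle, S ∈ Subgroup.zpowers T ∧
        ∀ a, S a ∈ K → ∀ b, S b ∈ K → dist a b < δ := by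
  replace hT := mt Metric.uniformEquicontinuous_iff.2 hT
  push Not at hT
  obtain ⟨ε, hε, hT⟩ := hT
  obtain ⟨𝒦, hfin, hopen, h𝒦⟩ := exists_finite_isOpen_subset_of_isPreconnected hε
  by_contra! hcon
  choose! δ hδ hcon using hcon
  -- As `𝒦` is finite, one scale lies below every `δ K`; some iterate stretches a connected set
  -- smaller than that scale over a member of `𝒦`.
  obtain ⟨δ₀, hδ₀, hle⟩ : ∃ δ₀ > 0, ∀ K ∈ 𝒦, δ₀ ≤ δ K := by
    have := hfin.to_subtype
    obtain ⟨δ₀, hδ₀, hle⟩ := exists_pos_forall_le (f := fun K : 𝒦 => δ K)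
      fun K => hδ K (hopen K K.2).1 (hopen K K.2).2
    exact ⟨δ₀, hδ₀, fun K hK => hle ⟨K, hK⟩⟩
  obtain ⟨η, hη, hconn⟩ := exists_isPreconnected_of_dist_lt Circle hδ₀
  obtain ⟨x, y, hxy, n, hn⟩ := hT η hη
  obtain ⟨C, hC, hxC, hyC, hCd⟩ := hconn x y hxy
  rw [iterate_eq_pow] at hn
  obtain ⟨K, hK, hKC⟩ := h𝒦 _ (hC.image _ (T ^ n).continuous.continuousOn) _
    (Set.mem_image_of_mem _ hxC) _ (Set.mem_image_of_mem _ hyC) hn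
  obtain ⟨a, ha, b, hb, hab⟩ := hcon K (hopen K hK).1 (hopen K hK).2 (T ^ n)
    (Subgroup.npow_mem_zpowers T n)
  have h1 := hCd a ((T ^ n).injective.mem_set_image.1 (hKC ha)) b
    ((T ^ n).injective.mem_set_image.1 (hKC hb))
  linarith [hle K hK]

/-- The translates of a set with arbitrarily small preimages do not cover an infinite space. -/
theorem exists_forall_zpow_notMem {X : Type*} [MetricSpace X] [CompactSpace X] [Infinite X]
    {T : X ≃ₜ X} {K : Set X} (hK : IsOpen K)
    (hsmall : ∀ δ > 0, ∃ S : X ≃ₜ X, S ∈ Subgroup.zpowers T ∧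
      ∀ a, S a ∈ K → ∀ b, S b ∈ K → dist a b < δ) :
    ∃ z, ∀ m : ℤ, (T ^ m) z ∉ K := by
  by_contra! hcov
  obtain ⟨s, hs⟩ := isCompact_univ.elim_finite_subcover (fun m : ℤ => (T ^ m) ⁻¹' K)
    (fun m => hK.preimage (T ^ m).continuous) fun z _ => Set.mem_iUnion.2 (hcov z)
  -- With more points than translates, two points of `P` have `T ^ n`-images in the same translate.
  -- Since powers of `T` commute, their `T ^ m`-images lie in a tiny preimage of `K`, and `T ^ (-m)`
  -- brings the two points closer than `d`.
  obtain ⟨P, hP⟩ := Infinite.exists_subset_card_eq X (s.card + 1)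
  obtain ⟨d, hd, hPd⟩ : ∃ d > 0, ∀ z ∈ P, ∀ w ∈ P, z ≠ w → d ≤ dist z w := by
    obtain ⟨d, hd, h⟩ := exists_pos_forall_le (f := fun z : (P : Set X).offDiag => dist z.1.1 z.1.2)
      fun z => dist_pos.2 z.2.2.2
    exact ⟨d, hd, fun z hz w hw hzw => h ⟨(z, w), hz, hw, hzw⟩⟩
  obtain ⟨δ, hδ, hs'⟩ : ∃ δ > 0, ∀ m ∈ s, ∀ a b, dist a b < δ →
      dist ((T ^ (-m)) a) ((T ^ (-m)) b) < d := by
    have h : UniformEquicontinuous fun m : s => (T ^ (-m : ℤ) : X ≃ₜ X) :=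
      uniformEquicontinuous_finite.2 fun m =>
        CompactSpace.uniformContinuous_of_continuous (T ^ (-m : ℤ) : X ≃ₜ X).continuous
    obtain ⟨δ, hδ, h⟩ := Metric.uniformEquicontinuous_iff.1 h d hd
    exact ⟨δ, hδ, fun m hm a b hab => h a b hab ⟨m, hm⟩⟩
  obtain ⟨S, ⟨n, rfl⟩, hS⟩ := hsmall δ hδ
  have hm : ∀ z, ∃ m ∈ s, (T ^ m) ((T ^ n) z) ∈ K := fun z => by
    simpa using hs (Set.mem_univ ((T ^ n) z))
  choose m hms hmK using hm
  obtain ⟨z, hz, w, hw, hzw, hmzw⟩ := Finset.exists_ne_map_eq_of_card_lt_of_maps_to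
    (s := P) (t := s) (f := m) (by omega) fun z _ => hms z
  have hcomm : ∀ x, (T ^ n) ((T ^ m z) x) = (T ^ m z) ((T ^ n) x) := fun x =>
    DFunLike.congr_fun (zpow_mul_comm T n (m z)) x
  have h1 := hS ((T ^ m z) z) (by rw [hcomm]; exact hmK z) ((T ^ m z) w)
    (by rw [hcomm, hmzw]; exact hmK w)
  have h2 := hs' (m z) (hms z) _ _ h1
  have hinv : ∀ x, (T ^ (-m z)) ((T ^ m z) x) = x := fun x => by
    rw [zpow_neg]
    exact (T ^ m z).symm_apply_apply x
  rw [hinv, hinv] at h2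
  exact absurd h2 (not_lt.2 (hPd z hz w hw hzw))

/-- An orbit inside a finite set repeats, and injectivity turns the repetition into a return to the
start; for negative `m` the inverse power fixes the same point. -/
theorem exists_pow_apply_eq_of_zpow_image_eq {X : Type*} [TopologicalSpace X] {T : X ≃ₜ X} {m : ℤ}
    (hm : m ≠ 0) {F : Set X} (hF : F.Finite) (hne : F.Nonempty) (hTF : (T ^ m) '' F = F) :
    ∃ q : ℕ, 0 < q ∧ ∃ z, (T ^ q) z = z := by
  obtain ⟨z, hz⟩ := hne
  have hmem : ∀ n : ℕ, (T ^ m : X ≃ₜ X)^[n] z ∈ F := fun n => by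
    induction n with
    | zero => exact hz
    | succ n ih =>
      rw [Function.iterate_succ_apply', ← hTF]
      exact Set.mem_image_of_mem _ ih
  obtain ⟨a, b, hab, heq⟩ := hF.exists_lt_map_eq_of_forall_mem hmem
  obtain ⟨c, rfl⟩ := Nat.exists_eq_add_of_lt hab
  rw [add_assoc, Function.iterate_add_apply] at heq
  have hz' := ((T ^ m : X ≃ₜ X).injective.iterate a) heq
  rw [iterate_eq_pow, ← zpow_natCast, ← zpow_mul] at hz'
  refine ⟨m.natAbs * (c + 1), Nat.mul_pos (Int.natAbs_pos.2 hm) c.succ_pos, z, ?_⟩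
  rw [← zpow_natCast, Nat.cast_mul]
  rcases abs_choice m with h | h
  · rw [Int.natCast_natAbs, h]
    exact hz'.symm
  · rw [Int.natCast_natAbs, h, neg_mul, zpow_neg]
    exact (Homeomorph.symm_apply_eq _).2 hz'

/-- The forward iterates of a circle homeomorphism are equicontinuous unless some point is isolated
in its orbit under an iterate. -/
theorem uniformEquicontinuous_or_hasIsolatedOrbitPoint (T : Circle ≃ₜ Circle) :
    UniformEquicontinuous (fun n : ℕ => (T : Circle → Circle)^[n]) ∨ HasIsolatedOrbitPoint T := by
  refine or_iff_not_imp_left.2 fun hT => ?_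
  have hperiodic : ∀ {q : ℕ} {z : Circle}, 0 < q → (T ^ q) z = z → HasIsolatedOrbitPoint T :=
    fun hq hz => (pow_eq_one_or_hasIsolatedOrbitPoint hq hz).resolve_left fun h =>
      hT (uniformEquicontinuous_iterate_of_pow_eq_one (by omega) h)
  obtain ⟨K, hKo, ⟨x, hxK⟩, hsmall⟩ := exists_isOpen_small_preimages hT
  obtain ⟨z, hz⟩ := exists_forall_zpow_notMem hKo hsmall
  set V : Set Circle := ⋃ m : ℤ, (T ^ m) ⁻¹' K with hV
  have hVo : IsOpen V := isOpen_iUnion fun m => hKo.preimage (T ^ m).continuous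
  have hzV : z ∉ V := by simpa [hV] using hz
  have hxV : x ∈ V := Set.mem_iUnion.2 ⟨0, hxK⟩
  have hVinv : ∀ m : ℤ, (T ^ m) '' V = V := fun m => by
    ext w
    simp only [hV, Set.mem_image, Set.mem_iUnion, Set.mem_preimage]
    constructor
    · rintro ⟨y, ⟨k, hk⟩, rfl⟩
      refine ⟨k - m, ?_⟩
      rwa [← Homeomorph.mul_apply, ← zpow_add, sub_add_cancel]
    · rintro ⟨k, hk⟩
      refine ⟨(T ^ (-m)) w, ⟨k + m, ?_⟩, ?_⟩
      · rwa [← Homeomorph.mul_apply, ← zpow_add, add_neg_cancel_right]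
      · rw [zpow_neg]
        exact (T ^ m).apply_symm_apply w
  set I := connectedComponentIn V x with hI
  have hIo : IsOpen I := hVo.connectedComponentIn
  have hxI : x ∈ I := mem_connectedComponentIn hxV
  have hIV : I ⊆ V := connectedComponentIn_subset V x
  by_cases hw : ∀ m : ℤ, m ≠ 0 → (T ^ m) x ∉ I
  · exact ⟨1, one_pos, x, I, hIo, hxI, by simpa using hw⟩
  · push Not at hw
    obtain ⟨m, hm, hmI⟩ := hw
    -- `T ^ m` permutes the components of the invariant set `V`, and two components sharing a point
    -- coincide.
    have hTI : (T ^ m) '' I = I := by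
      rw [hI, (T ^ m).image_connectedComponentIn hxV, hVinv]
      exact (connectedComponentIn_eq hmI).symm
    -- The frontier is nonempty because the circle is connected and `I` contains `x` but not `z`.
    obtain ⟨q, hq, w, hw⟩ := exists_pow_apply_eq_of_zpow_image_eq hm (F := frontier I)
      (finite_frontier_of_isPreconnected isPreconnected_connectedComponentIn) (by
        rw [Set.nonempty_iff_ne_empty, Ne, ← isClopen_iff_frontier_eq_empty, isClopen_iff]
        rintro (h | h)
        · exact Set.notMem_empty x (h ▸ hxI)
        · exact hzV (hIV (h ▸ Set.mem_univ z)))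
      (by rw [Homeomorph.image_frontier, hTI])
    exact hperiodic hq hw

end GrowthOrder

theorem corollary3 (T : Circle ≃ₜ Circle)
    (ρ : GrowthOrder.CompatibleMetric (MeasureTheory.ProbabilityMeasure Circle)) :
    GrowthOrder.supOrders GrowthOrder.polynomialOrders ≤
        GrowthOrder.genEntropy ρ (GrowthOrder.measureInduced (T : C(Circle, Circle))) ∨
      GrowthOrder.genEntropy ρ (GrowthOrder.measureInduced (T : C(Circle, Circle))) =
        GrowthOrder.constOrder := by
  rcases GrowthOrder.uniformEquicontinuous_or_hasIsolatedOrbitPoint T with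
    h | ⟨q, hq, x, U, hU, hx, hxU⟩
  · exact Or.inr (GrowthOrder.genEntropy_measureInduced_eq_constOrder ρ _ h)
  · exact Or.inl (GrowthOrder.supOrders_polynomialOrders_le_measureInduced ρ T hq hU hx hxU)
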